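/- Let $P=(p_{jk})$ be a $b_0\times b_1$ probability matrix, i.e. $p_{jk}\ge 0$ and $\sum_{j,k}p_{jk}=1$, with marginals $p_{j*}=\sum_k p_{jk}$ and $p_{*k}=\sum_j p_{jk}$. For $d\ge 1$, $x\in\{0,\dots,b_0-1\}^d$ and $y\in\{0,\dots,b_1-1\}^d$ put $p_{x*}=\prod_{i=1}^d p_{x_i*}$, $p_{*y}=\prod_{i=1}^d p_{*y_i}$, $p_{xy}=\prod_{i=1}^d p_{x_iy_i}$, and extend these additively to sets: $p_{B_0*}=\sum_{x\in B_0}p_{x*}$, $p_{*B_1}=\sum_{y\in B_1}p_{*y}$, $p_A=\sum_{(x,y)\in A}p_{xy}$. A $d$-dimensional bucketing code is a finite list of pairs $(B_{0,t},B_{1,t})_{0\le t<T}$ with $B_{0,t}\subset\{0,\dots,b_0-1\}^d$ and $B_{1,t}\subset\{0,\dots,b_1-1\}^d$. Its success probability is $$S=p_{\bigcup_{t}B_{0,t}\times B_{1,t}},$$ and for real numbers $n_0,n_1>0$ its work is $$W=\sum_{t=0}^{T-1}\max\bigl(n_0p_{B_{0,t}*},\ n_1p_{*B_{1,t}},\ n_0p_{B_{0,t}*}\,n_1p_{*B_{1,t}}\bigr).$$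 Call $(P,d,n_0,n_1,\tilde S,\tilde W)$ attainable if some $d$-dimensional bucketing code has success probability $S\ge\tilde S\ge 0$ and, for $n_0,n_1$, work $W\le\tilde W$. The log-attainable set of $P$ is $$D(P)=\Bigl\{\tfrac1d(\ln n_0,\ln n_1,-\ln S,\ln W)\ :\ d\ge 1,\ n_0,n_1,S,W>0,\ (P,d,n_0,n_1,S,W)\text{ is attainable}\Bigr\}\subset\mathbb R^4,$$ and $D^c(P)$ denotes its closure in $\mathbb R^4$. Theorem. For any probability matrices $P_1$ and $P_2$ (of arbitrary, possibly different, finite dimensions), with tensor (Kronecker) product $P_1\times P_2$, $$D^c(P_1\times P_2)=D^c(P_1)+D^c(P_2),$$ where the right-hand side is the Minkowski sum $\{u+v : u\in D^c(P_1),\ v\in D^c(P_2)\}$. -/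

import Mathlib

open scoped Kronecker Pointwise

noncomputable section

namespace Bucketing

variable {ι κ : Type*} [Fintype ι] [Fintype κ]

/-- A probability matrix: nonnegative entries with total sum one. -/
structure IsProbMatrix (P : Matrix ι κ ℝ) : Prop where
  nonneg : ∀ j k, 0 ≤ P j k
  sum_eq_one : ∑ j, ∑ k, P j k = 1

/-- Row marginal `p_{j*}`. -/
def rowMarginal (P : Matrix ι κ ℝ) (j : ι) : ℝ := ∑ k, P j k

/-- Column marginal `p_{*k}`. -/
def colMarginal (P : Matrix ι κ ℝ) (k : κ) : ℝ := ∑ j, P j k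

/-- `p_{B₀*}`: the probability that a single point of the first bag lies in `B₀`. -/
def rowProb (P : Matrix ι κ ℝ) {d : ℕ} (B : Finset (Fin d → ι)) : ℝ :=
  ∑ x ∈ B, ∏ i, rowMarginal P (x i)

/-- `p_{*B₁}`: the probability that a single point of the second bag lies in `B₁`. -/
def colProb (P : Matrix ι κ ℝ) {d : ℕ} (B : Finset (Fin d → κ)) : ℝ :=
  ∑ y ∈ B, ∏ i, colMarginal P (y i)

/-- The probability that the special pair lies in the set `A` of pairs of points. -/
def pairProb (P : Matrix ι κ ℝ) {d : ℕ} (A : Finset ((Fin d → ι) × (Fin d → κ))) : ℝ :=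
  ∑ z ∈ A, ∏ i, P (z.1 i) (z.2 i)

/-- A `d`-dimensional bucketing code: finitely many pairs of (data independent) subsets of the
two spaces of points. -/
structure Code (ι κ : Type*) (d : ℕ) where
  /-- the number of bucket pairs -/
  T : ℕ
  /-- the buckets of the first bag -/
  B₀ : Fin T → Finset (Fin d → ι)
  /-- the buckets of the second bag -/
  B₁ : Fin T → Finset (Fin d → κ)

open Classical in
/-- Success probability: the probability that the special pair falls into a common bucket pair. -/
def Code.success {d : ℕ} (C : Code ι κ d) (P : Matrix ι κ ℝ) : ℝ :=
  pairProb P (Finset.univ.biUnion fun t => C.B₀ t ×ˢ C.B₁ t)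

/-- Work of a bucketing code for expected numbers of points `n₀`, `n₁`. -/
def Code.work {d : ℕ} (C : Code ι κ d) (P : Matrix ι κ ℝ) (n₀ n₁ : ℝ) : ℝ :=
  ∑ t, max (max (n₀ * rowProb P (C.B₀ t)) (n₁ * colProb P (C.B₁ t)))
    ((n₀ * rowProb P (C.B₀ t)) * (n₁ * colProb P (C.B₁ t)))

/-- `(P, d, n₀, n₁, S, W)` is attainable. -/
def Attainable (P : Matrix ι κ ℝ) (d : ℕ) (n₀ n₁ S W : ℝ) : Prop :=
  1 ≤ d ∧ 0 < n₀ ∧ 0 < n₁ ∧ 0 ≤ S ∧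
    ∃ C : Code ι κ d, S ≤ C.success P ∧ C.work P n₀ n₁ ≤ W

/-- The log-attainable set `D(P)`. The conditions `0 < S`, `0 < W` say that the logarithms are
finite, so that the point lies in `ℝ⁴`. -/
def logAttainable (P : Matrix ι κ ℝ) : Set (ℝ × ℝ × ℝ × ℝ) :=
  {v | ∃ (d : ℕ) (n₀ n₁ S W : ℝ), Attainable P d n₀ n₁ S W ∧ 0 < S ∧ 0 < W ∧
    v = (Real.log n₀ / d, Real.log n₁ / d, -Real.log S / d, Real.log W / d)}

end Bucketing

end

noncomputable section

set_option linter.unusedSectionVars false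

namespace Bucketing

variable {A B A' B' : Type*} [Fintype A] [Fintype B] [Fintype A'] [Fintype B']

/-! The inclusion of the sum is the product construction: products of buckets multiply the success
probabilities, and the works at most multiply because max(x, y, xy) is submultiplicative
(`CodeExists.kronecker`). Tensor powers first bring the two codes to a common dimension.

For the converse, raise a code for P × Q to a high power, of dimension D, and view it as a code for
M ⊗ N, where M and N are the D-th tensor powers of P and Q. Over each pair z of M-points, the slices
of the buckets form a code for N. Sort these sliced bucket pairs by their two marginal
probabilities, and the pairs z by the success probability and the number of slices in the chosen
class, all up to a factor e. Nonzero entries of N are at least exp(-L) with L linear in D, so there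
are at most (L+1)^4 classes, and one of them carries a fraction (L+1)^(-4) of the success. For a z
in that class, the slices give a code for N whose bucket pairs each cost at most 1. For M, keep in
each bucket the points whose slice has the right size. By Markov's inequality this is paid for by
scaling n₀ and n₁ down; every z in the class is then covered about exp(j) times, so a family with
about exp(-j) of the work still covers half of the class (`exists_subcover`). The parameters of the
two codes multiply to the original ones up to a factor polynomial in D (`CodeExists.split`). After
taking logarithms and dividing by D the error tends to 0. The point for Q stays in a fixed box, and
a closed set plus a compact set is closed, so the limit splits as well. -/

/-- The larger of `x`, `y` and `x * y`. -/
def cost (x y : ℝ) : ℝ := max (max x y) (x * y)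

lemma cost_nonneg {x y : ℝ} (hx : 0 ≤ x) : 0 ≤ cost x y :=
  hx.trans ((le_max_left _ _).trans (le_max_left _ _))

lemma cost_mono {x y x' y' : ℝ} (hx : 0 ≤ x') (hy : 0 ≤ y) (hxx : x ≤ x') (hyy : y ≤ y') :
    cost x y ≤ cost x' y' := by
  unfold cost
  gcongr

lemma cost_le_one {x y : ℝ} (hy : 0 ≤ y) (hx1 : x ≤ 1) (hy1 : y ≤ 1) :
    cost x y ≤ 1 :=
  max_le (max_le hx1 hy1) (mul_le_one₀ hx1 hy hy1)

/-- Each of the three terms of the maximum factors. This is what makes work submultiplicative under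
products of codes. -/
lemma cost_mul_le {x y x' y' : ℝ} (hx : 0 ≤ x) (hx' : 0 ≤ x') (hy' : 0 ≤ y') :
    cost (x * x') (y * y') ≤ cost x y * cost x' y' := by
  have h₁ : x ≤ cost x y := (le_max_left _ _).trans (le_max_left _ _)
  have h₂ : y ≤ cost x y := (le_max_right _ _).trans (le_max_left _ _)
  have h₃ : x * y ≤ cost x y := le_max_right _ _
  have h₁' : x' ≤ cost x' y' := (le_max_left _ _).trans (le_max_left _ _)
  have h₂' : y' ≤ cost x' y' := (le_max_right _ _).trans (le_max_left _ _)
  have h₃' : x' * y' ≤ cost x' y' := le_max_right _ _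
  have h0 := hx.trans h₁
  refine max_le (max_le (mul_le_mul h₁ h₁' hx' h0) (mul_le_mul h₂ h₂' hy' h0)) ?_
  rw [mul_mul_mul_comm]
  exact mul_le_mul h₃ h₃' (mul_nonneg hx' hy') h0

/-! ### One-shot codes for a single matrix, and their products -/

/-- The pairs that lie in a common bucket pair with index in `s`. -/
def coverSet {T : Type*} (s : Finset T) (B₀ : T → Finset A) (B₁ : T → Finset B) : Set (A × B) :=
  {z | ∃ t ∈ s, z.1 ∈ B₀ t ∧ z.2 ∈ B₁ t}

/-- The total weight of the pairs that lie in a common bucket pair with index in `s`. -/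
def coverProb (M : Matrix A B ℝ) {T : Type*} (s : Finset T) (B₀ : T → Finset A)
    (B₁ : T → Finset B) : ℝ :=
  ∑ z : A × B, (coverSet s B₀ B₁).indicator (fun z => M z.1 z.2) z

/-- The work of the bucket pairs with index in `s`. -/
def familyWork (M : Matrix A B ℝ) (n₀ n₁ : ℝ) {T : Type*} (s : Finset T) (B₀ : T → Finset A)
    (B₁ : T → Finset B) : ℝ :=
  ∑ t ∈ s, cost (n₀ * ∑ a ∈ B₀ t, rowMarginal M a) (n₁ * ∑ b ∈ B₁ t, colMarginal M b)

/-- There is a one-dimensional bucketing code for `M` with success at least `S` and work at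
most `W`. -/
def CodeExists (M : Matrix A B ℝ) (n₀ n₁ S W : ℝ) : Prop :=
  ∃ (n : ℕ) (B₀ : Fin n → Finset A) (B₁ : Fin n → Finset B),
    S ≤ coverProb M Finset.univ B₀ B₁ ∧ familyWork M n₀ n₁ Finset.univ B₀ B₁ ≤ W

lemma CodeExists.of_family {M : Matrix A B ℝ} {n₀ n₁ S W : ℝ} {T : Type*} (s : Finset T)
    (B₀ : T → Finset A) (B₁ : T → Finset B) (hS : S ≤ coverProb M s B₀ B₁)
    (hW : familyWork M n₀ n₁ s B₀ B₁ ≤ W) : CodeExists M n₀ n₁ S W := by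
  refine ⟨s.card, fun i => B₀ (s.equivFin.symm i), fun i => B₁ (s.equivFin.symm i), ?_, ?_⟩
  · convert hS using 1
    unfold coverProb
    congr! 2
    ext z
    refine ⟨?_, ?_⟩
    · rintro ⟨i, -, h⟩
      exact ⟨_, (s.equivFin.symm i).2, h⟩
    · rintro ⟨t, ht, h⟩
      exact ⟨s.equivFin ⟨t, ht⟩, Finset.mem_univ _, by simpa using h⟩
  · convert hW using 1
    unfold familyWork
    rw [← Finset.sum_coe_sort s]
    exact Equiv.sum_comp s.equivFin.symm (fun t : s => cost (n₀ * ∑ a ∈ B₀ t, rowMarginal M a)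
      (n₁ * ∑ b ∈ B₁ t, colMarginal M b))

lemma rowMarginal_nonneg {M : Matrix A B ℝ} (hM : ∀ a b, 0 ≤ M a b) (a : A) :
    0 ≤ rowMarginal M a := Finset.sum_nonneg fun _ _ => hM _ _

lemma colMarginal_nonneg {M : Matrix A B ℝ} (hM : ∀ a b, 0 ≤ M a b) (b : B) :
    0 ≤ colMarginal M b := Finset.sum_nonneg fun _ _ => hM _ _

lemma rowMarginal_kronecker (M : Matrix A B ℝ) (N : Matrix A' B' ℝ) (x : A × A') :
    rowMarginal (M ⊗ₖ N) x = rowMarginal M x.1 * rowMarginal N x.2 := by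
  simp [rowMarginal, Fintype.sum_prod_type, Finset.sum_mul_sum, Matrix.kroneckerMap_apply]

lemma colMarginal_kronecker (M : Matrix A B ℝ) (N : Matrix A' B' ℝ) (y : B × B') :
    colMarginal (M ⊗ₖ N) y = colMarginal M y.1 * colMarginal N y.2 := by
  simp [colMarginal, Fintype.sum_prod_type, Finset.sum_mul_sum, Matrix.kroneckerMap_apply]

lemma familyWork_nonneg {M : Matrix A B ℝ} (hM : ∀ a b, 0 ≤ M a b) {n₀ n₁ : ℝ} (hn₀ : 0 ≤ n₀)
    {T : Type*} (s : Finset T) (B₀ : T → Finset A) (B₁ : T → Finset B) :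
    0 ≤ familyWork M n₀ n₁ s B₀ B₁ :=
  Finset.sum_nonneg fun _ _ => cost_nonneg
    (mul_nonneg hn₀ (Finset.sum_nonneg fun _ _ => rowMarginal_nonneg hM _))

lemma coverProb_nonneg {M : Matrix A B ℝ} (hM : ∀ a b, 0 ≤ M a b)
    {T : Type*} (s : Finset T) (B₀ : T → Finset A) (B₁ : T → Finset B) :
    0 ≤ coverProb M s B₀ B₁ :=
  Finset.sum_nonneg fun _ _ => Set.indicator_nonneg (fun _ _ => hM _ _) _

/-- Take all products of a bucket pair of one code with a bucket pair of the other. Marginals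
factor, so success is exactly multiplicative and work is bounded by `cost_mul_le`. -/
lemma CodeExists.kronecker {M : Matrix A B ℝ} {N : Matrix A' B' ℝ}
    (hM : ∀ a b, 0 ≤ M a b) (hN : ∀ a b, 0 ≤ N a b) {n₀ n₁ S W n₀' n₁' S' W' : ℝ}
    (hn₀ : 0 ≤ n₀) (hn₀' : 0 ≤ n₀') (hn₁' : 0 ≤ n₁') (hS' : 0 ≤ S')
    (h : CodeExists M n₀ n₁ S W) (h' : CodeExists N n₀' n₁' S' W') :
    CodeExists (M ⊗ₖ N) (n₀ * n₀') (n₁ * n₁') (S * S') (W * W') := by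
  obtain ⟨n, B₀, B₁, hs, hw⟩ := h
  obtain ⟨n', B₀', B₁', hs', hw'⟩ := h'
  refine CodeExists.of_family (Finset.univ : Finset (Fin n × Fin n'))
    (fun t => B₀ t.1 ×ˢ B₀' t.2) (fun t => B₁ t.1 ×ˢ B₁' t.2) ?_ ?_
  · refine (mul_le_mul hs hs' hS' (coverProb_nonneg hM _ _ _)).trans (le_of_eq ?_)
    unfold coverProb
    rw [Finset.sum_mul_sum, ← Fintype.sum_prod_type',
      ← Equiv.sum_comp (Equiv.prodProdProdComm A A' B B')]
    refine Finset.sum_congr rfl fun z _ => ?_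
    classical
    simp only [Set.indicator_apply, ← ite_and, ite_mul, mul_ite, mul_zero, zero_mul]
    refine if_congr ⟨?_, ?_⟩ rfl rfl
    · rintro ⟨⟨t', -, h₃, h₄⟩, t, -, h₁, h₂⟩
      exact ⟨(t, t'), Finset.mem_univ _, Finset.mem_product.2 ⟨h₁, h₃⟩,
        Finset.mem_product.2 ⟨h₂, h₄⟩⟩
    · rintro ⟨⟨t, t'⟩, -, h₁, h₂⟩
      rw [Finset.mem_product] at h₁ h₂
      exact ⟨⟨t', Finset.mem_univ _, h₁.2, h₂.2⟩, t, Finset.mem_univ _, h₁.1, h₂.1⟩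
  · refine le_trans ?_ (mul_le_mul hw hw' (familyWork_nonneg hN hn₀' _ _ _)
      ((familyWork_nonneg hM hn₀ _ _ _).trans hw))
    unfold familyWork
    rw [Finset.sum_mul_sum, ← Fintype.sum_prod_type']
    refine Finset.sum_le_sum fun t _ => ?_
    simp only [rowMarginal_kronecker, colMarginal_kronecker]
    rw [Finset.sum_product, Finset.sum_product, ← Finset.sum_mul_sum, ← Finset.sum_mul_sum,
      mul_mul_mul_comm, mul_mul_mul_comm n₁]
    apply cost_mul_le
    all_goals
      refine mul_nonneg ‹_› (Finset.sum_nonneg fun _ _ => ?_)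
      first
      | exact rowMarginal_nonneg hM _
      | exact rowMarginal_nonneg hN _
      | exact colMarginal_nonneg hM _
      | exact colMarginal_nonneg hN _

lemma CodeExists.reindex {M : Matrix A B ℝ} {n₀ n₁ S W : ℝ} (h : CodeExists M n₀ n₁ S W)
    (e : A' ≃ A) (f : B' ≃ B) : CodeExists (M.submatrix e f) n₀ n₁ S W := by
  obtain ⟨n, B₀, B₁, hs, hw⟩ := h
  refine ⟨n, fun t => (B₀ t).map e.symm.toEmbedding, fun t => (B₁ t).map f.symm.toEmbedding, ?_, ?_⟩
  · convert hs using 1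
    unfold coverProb
    rw [← Equiv.sum_comp (e.prodCongr f)]
    refine Finset.sum_congr rfl fun z _ => ?_
    classical
    simp [Set.indicator_apply, coverSet, Finset.mem_map_equiv]
  · convert hw using 1
    unfold familyWork
    have hr : ∀ a, rowMarginal (M.submatrix e f) (e.symm a) = rowMarginal M a := fun a => by
      simpa [rowMarginal] using Equiv.sum_comp f (fun b => M a b)
    have hc : ∀ b, colMarginal (M.submatrix e f) (f.symm b) = colMarginal M b := fun b => by
      simpa [colMarginal] using Equiv.sum_comp e (fun a => M a b)
    simp [hr, hc]

/-! ### Tensor powers, and attainability as a one-shot property -/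

/-- The `d`-fold tensor power of a matrix. -/
def tensorPow (P : Matrix A B ℝ) (d : ℕ) : Matrix (Fin d → A) (Fin d → B) ℝ :=
  fun x y => ∏ i, P (x i) (y i)

lemma tensorPow_nonneg {P : Matrix A B ℝ} (hP : ∀ a b, 0 ≤ P a b) (d : ℕ) (x y) :
    0 ≤ tensorPow P d x y := Finset.prod_nonneg fun _ _ => hP _ _

lemma rowMarginal_tensorPow (P : Matrix A B ℝ) (d : ℕ) (x : Fin d → A) :
    rowMarginal (tensorPow P d) x = ∏ i, rowMarginal P (x i) := by
  classical
  simp [rowMarginal, tensorPow, Finset.prod_univ_sum]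

lemma colMarginal_tensorPow (P : Matrix A B ℝ) (d : ℕ) (y : Fin d → B) :
    colMarginal (tensorPow P d) y = ∏ i, colMarginal P (y i) := by
  classical
  simp [colMarginal, tensorPow, Finset.prod_univ_sum]

lemma IsProbMatrix.tensorPow {P : Matrix A B ℝ} (hP : IsProbMatrix P) (d : ℕ) :
    IsProbMatrix (tensorPow P d) := by
  classical
  refine ⟨tensorPow_nonneg hP.nonneg d, ?_⟩
  change ∑ x, rowMarginal (Bucketing.tensorPow P d) x = 1
  simp_rw [rowMarginal_tensorPow]
  have := Finset.prod_univ_sum (fun _ : Fin d => (Finset.univ : Finset A))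
    (fun _ a => rowMarginal P a)
  rw [Fintype.piFinset_univ] at this
  rw [← this]
  simp [rowMarginal, hP.sum_eq_one]

lemma tensorPow_kronecker (P : Matrix A B ℝ) (Q : Matrix A' B' ℝ) (d : ℕ) :
    tensorPow (P ⊗ₖ Q) d = (tensorPow P d ⊗ₖ tensorPow Q d).submatrix
      (Equiv.arrowProdEquivProdArrow (Fin d) (fun _ => A) (fun _ => A'))
      (Equiv.arrowProdEquivProdArrow (Fin d) (fun _ => B) (fun _ => B')) := by
  ext x y
  simp [tensorPow, Matrix.kroneckerMap_apply, Finset.prod_mul_distrib]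

lemma tensorPow_add (P : Matrix A B ℝ) (d d' : ℕ) :
    tensorPow P (d + d') = (tensorPow P d ⊗ₖ tensorPow P d').submatrix
      (Fin.appendEquiv d d').symm (Fin.appendEquiv d d').symm := by
  ext x y
  simp [tensorPow, Matrix.kroneckerMap_apply, Fin.prod_univ_add, Fin.appendEquiv]

lemma attainable_iff {P : Matrix A B ℝ} {d : ℕ} {n₀ n₁ S W : ℝ} :
    Attainable P d n₀ n₁ S W ↔
      1 ≤ d ∧ 0 < n₀ ∧ 0 < n₁ ∧ 0 ≤ S ∧ CodeExists (tensorPow P d) n₀ n₁ S W := by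
  classical
  have hs : ∀ C : Code A B d, C.success P = coverProb (tensorPow P d) Finset.univ C.B₀ C.B₁ := by
    intro C
    unfold coverProb
    simp only [Set.indicator_apply]
    refine Eq.trans (Finset.sum_congr ?_ fun _ _ => rfl) (Finset.sum_filter _ _)
    ext z
    rw [Finset.mem_filter, coverSet, Set.mem_ofPred_eq]
    simp
  have hw : ∀ C : Code A B d,
      C.work P n₀ n₁ = familyWork (tensorPow P d) n₀ n₁ Finset.univ C.B₀ C.B₁ := by
    intro C
    simp [Code.work, familyWork, cost, rowProb, colProb, rowMarginal_tensorPow,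
      colMarginal_tensorPow]
  unfold Attainable
  refine and_congr_right fun _ => and_congr_right fun _ => and_congr_right fun _ =>
    and_congr_right fun _ => ⟨?_, ?_⟩
  · rintro ⟨C, h₁, h₂⟩
    exact ⟨C.T, C.B₀, C.B₁, hs C ▸ h₁, hw C ▸ h₂⟩
  · rintro ⟨n, B₀, B₁, h₁, h₂⟩
    exact ⟨⟨n, B₀, B₁⟩, (hs ⟨n, B₀, B₁⟩).symm ▸ h₁, (hw ⟨n, B₀, B₁⟩).symm ▸ h₂⟩

/-! ### Products of attainable points: the inclusion of the sum -/

lemma Attainable.kronecker {P : Matrix A B ℝ} {Q : Matrix A' B' ℝ}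
    (hP : ∀ a b, 0 ≤ P a b) (hQ : ∀ a b, 0 ≤ Q a b) {d : ℕ} {n₀ n₁ S W n₀' n₁' S' W' : ℝ}
    (h : Attainable P d n₀ n₁ S W) (h' : Attainable Q d n₀' n₁' S' W') :
    Attainable (P ⊗ₖ Q) d (n₀ * n₀') (n₁ * n₁') (S * S') (W * W') := by
  rw [attainable_iff] at *
  obtain ⟨hd, h₀, h₁, hS, h⟩ := h
  obtain ⟨-, h₀', h₁', hS', h'⟩ := h'
  refine ⟨hd, mul_pos h₀ h₀', mul_pos h₁ h₁', mul_nonneg hS hS', ?_⟩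
  rw [tensorPow_kronecker]
  exact (h.kronecker (tensorPow_nonneg hP d) (tensorPow_nonneg hQ d) h₀.le h₀'.le h₁'.le
    hS' h').reindex _ _

lemma Attainable.add {P : Matrix A B ℝ} (hP : ∀ a b, 0 ≤ P a b) {d d' : ℕ}
    {n₀ n₁ S W n₀' n₁' S' W' : ℝ}
    (h : Attainable P d n₀ n₁ S W) (h' : Attainable P d' n₀' n₁' S' W') :
    Attainable P (d + d') (n₀ * n₀') (n₁ * n₁') (S * S') (W * W') := by
  rw [attainable_iff] at *
  obtain ⟨hd, h₀, h₁, hS, h⟩ := h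
  obtain ⟨-, h₀', h₁', hS', h'⟩ := h'
  refine ⟨by omega, mul_pos h₀ h₀', mul_pos h₁ h₁', mul_nonneg hS hS', ?_⟩
  rw [tensorPow_add]
  exact (h.kronecker (tensorPow_nonneg hP d) (tensorPow_nonneg hP d') h₀.le h₀'.le h₁'.le
    hS' h').reindex _ _

lemma Attainable.pow {P : Matrix A B ℝ} (hP : ∀ a b, 0 ≤ P a b) {d : ℕ} {n₀ n₁ S W : ℝ}
    (h : Attainable P d n₀ n₁ S W) (n : ℕ) :
    Attainable P ((n + 1) * d) (n₀ ^ (n + 1)) (n₁ ^ (n + 1)) (S ^ (n + 1)) (W ^ (n + 1)) := by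
  induction n with
  | zero => simpa using h
  | succ n ih =>
    have := ih.add hP h
    rwa [← Nat.succ_mul, ← pow_succ, ← pow_succ, ← pow_succ, ← pow_succ] at this

lemma logAttainable_add_subset {P : Matrix A B ℝ} {Q : Matrix A' B' ℝ}
    (hP : ∀ a b, 0 ≤ P a b) (hQ : ∀ a b, 0 ≤ Q a b) :
    logAttainable P + logAttainable Q ⊆ logAttainable (P ⊗ₖ Q) := by
  rintro _ ⟨_, ⟨d, n₀, n₁, S, W, h, hS, hW, rfl⟩, _, ⟨d', n₀', n₁', S', W', h', hS', hW', rfl⟩, rfl⟩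
  have hd : 1 ≤ d := h.1
  have hd' : 1 ≤ d' := h'.1
  obtain ⟨n, rfl⟩ : ∃ n, d = n + 1 := ⟨d - 1, by omega⟩
  obtain ⟨n', rfl⟩ : ∃ n', d' = n' + 1 := ⟨d' - 1, by omega⟩
  -- Raising each code to the dimension of the other gives both the dimension d * d' without
  -- changing the normalised logarithms.
  have hp := h.pow hP n'
  have hp' := h'.pow hQ n
  rw [mul_comm] at hp'
  have key := hp.kronecker hP hQ hp'
  refine ⟨_, _, _, _, _, key, by positivity, by positivity, ?_⟩
  have e : ∀ x y : ℝ, 0 < x → 0 < y → Real.log (x ^ (n' + 1) * y ^ (n + 1)) /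
      (((n' + 1) * (n + 1) : ℕ) : ℝ) = Real.log x / ((n + 1 : ℕ) : ℝ) +
        Real.log y / ((n' + 1 : ℕ) : ℝ) := by
    intro x y hx hy
    rw [Real.log_mul (by positivity) (by positivity), Real.log_pow, Real.log_pow]
    push_cast
    field_simp
  simp only [neg_div, Prod.mk_add_mk]
  rw [e _ _ h.2.1 h'.2.1, e _ _ h.2.2.1 h'.2.2.1, e _ _ hS hS', e _ _ hW hW', neg_add]

/-! ### Thinning out a family of bucket pairs -/

open Classical in
/-- If every point of `X` is covered at least `τ` times by sets of total weight at most `W`, then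
some of these sets have total weight at most `2 * W / τ` and cover half of the mass of `X`. -/
lemma exists_subcover {T Z : Type*} (s : Finset T) (w : T → ℝ) (hw : ∀ t, 0 ≤ w t)
    (C : T → Set Z) (X : Finset Z) (m : Z → ℝ) (hm : ∀ z, 0 ≤ m z) {τ W : ℝ} (hτ : 0 < τ)
    (hW : 0 < W) (hsW : ∑ t ∈ s, w t ≤ W) (hcov : ∀ z ∈ X, τ ≤ (s.filter fun t => z ∈ C t).card) :
    ∃ R ⊆ s, ∑ t ∈ R, w t ≤ 2 * W / τ ∧
      (∑ z ∈ X, m z) / 2 ≤ ∑ z ∈ X.filter (fun z => ∃ t ∈ R, z ∈ C t), m z := by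
  set μ := ∑ z ∈ X, m z with hμ
  rcases (Finset.sum_nonneg fun z _ => hm z : 0 ≤ μ).eq_or_lt with h0 | hpos
  · refine ⟨∅, Finset.empty_subset _, by simp; positivity, ?_⟩
    simp [hμ, ← h0]
  let cov : Finset T → ℝ := fun R => ∑ z ∈ X.filter (fun z => ∃ t ∈ R, z ∈ C t), m z
  -- The threshold of mass covered per unit of weight: even the full mass μ at rate c has weight
  -- only 2W/τ. A largest family meeting this rate is the desired one.
  set c := τ * μ / (2 * W) with hc
  have hcpos : 0 < c := by positivity
  obtain ⟨R, hR, hmax⟩ := Finset.exists_max_image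
    (s.powerset.filter fun R => c * ∑ t ∈ R, w t ≤ cov R) Finset.card
    ⟨∅, by simp [cov]⟩
  rw [Finset.mem_filter, Finset.mem_powerset] at hR
  have hcovle : cov R ≤ μ :=
    Finset.sum_le_sum_of_subset_of_nonneg (Finset.filter_subset _ _) fun z _ _ => hm z
  refine ⟨R, hR.1, ?_, ?_⟩
  · have h := hR.2.trans hcovle
    rw [le_div_iff₀ hτ]
    have : (∑ t ∈ R, w t) * τ * μ ≤ 2 * W * μ := by
      calc (∑ t ∈ R, w t) * τ * μ = 2 * W * (c * ∑ t ∈ R, w t) := by rw [hc]; field_simp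
        _ ≤ 2 * W * μ := by gcongr
    exact le_of_mul_le_mul_right this hpos
  · by_contra! hlt
    change cov R < μ / 2 at hlt
    set X' := X.filter fun z => ¬ ∃ t ∈ R, z ∈ C t with hX'
    have hsplit : cov R + ∑ z ∈ X', m z = μ := Finset.sum_filter_add_sum_filter_not _ _ _
    -- If more than half of the mass is uncovered, τ-fold covering makes the total gain over all
    -- sets exceed c * W, so some single set gains more than c times its weight. That set is new,
    -- and adding it contradicts maximality.
    have hgain : ∑ t ∈ s, c * w t < ∑ t ∈ s, ∑ z ∈ X'.filter (fun z => z ∈ C t), m z := by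
      calc ∑ t ∈ s, c * w t = c * ∑ t ∈ s, w t := (Finset.mul_sum _ _ _).symm
        _ ≤ c * W := by gcongr
        _ = τ * (μ / 2) := by rw [hc]; field_simp
        _ < τ * ∑ z ∈ X', m z := by gcongr; linarith
        _ = ∑ z ∈ X', τ * m z := Finset.mul_sum _ _ _
        _ ≤ ∑ z ∈ X', ∑ t ∈ s.filter (fun t => z ∈ C t), m z := by
          refine Finset.sum_le_sum fun z hz => ?_
          rw [Finset.sum_const, nsmul_eq_mul]
          exact mul_le_mul_of_nonneg_right (hcov z (Finset.mem_of_mem_filter z hz)) (hm z)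
        _ = _ := by
          simp_rw [Finset.sum_filter]
          exact Finset.sum_comm
    obtain ⟨t, hts, ht⟩ := Finset.exists_lt_of_sum_lt hgain
    have htR : t ∉ R := fun htR => by
      refine absurd ht (not_lt.2 ?_)
      rw [Finset.filter_false_of_mem]
      · simpa using mul_nonneg hcpos.le (hw t)
      · intro z hz hzt
        exact (Finset.mem_filter.1 hz).2 ⟨t, htR, hzt⟩
    have hins : cov R + ∑ z ∈ X'.filter (fun z => z ∈ C t), m z ≤ cov (insert t R) := by
      rw [← Finset.sum_union]
      · refine Finset.sum_le_sum_of_subset_of_nonneg ?_ fun z _ _ => hm z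
        intro z hz
        simp only [X', Finset.mem_union, Finset.mem_filter] at hz
        rw [Finset.mem_filter]
        rcases hz with ⟨h₁, t', h₂, h₃⟩ | ⟨⟨h₁, -⟩, h₂⟩
        · exact ⟨h₁, t', Finset.mem_insert_of_mem h₂, h₃⟩
        · exact ⟨h₁, t, Finset.mem_insert_self _ _, h₂⟩
      · refine Finset.disjoint_left.2 fun z hz hz' => ?_
        exact (Finset.mem_filter.1 (Finset.mem_of_mem_filter z hz')).2 (Finset.mem_filter.1 hz).2
    have := hmax (insert t R) (by
      rw [Finset.mem_filter, Finset.mem_powerset]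
      refine ⟨Finset.insert_subset hts hR.1, ?_⟩
      rw [Finset.sum_insert htR, mul_add]
      linarith [hR.2])
    rw [Finset.card_insert_of_notMem htR] at this
    omega

-- One index per covered pair suffices. The bound on the number of bucket pairs keeps the count
-- level j within the range of the other levels.
open Classical in
lemma exists_subfamily_card_le {T : Type*} (s : Finset T) (B₀ : T → Finset A)
    (B₁ : T → Finset B) :
    ∃ R ⊆ s, R.card ≤ Fintype.card (A × B) ∧ coverSet R B₀ B₁ = coverSet s B₀ B₁ := by
  have h : ∀ z : coverSet s B₀ B₁, ∃ t ∈ s, z.1.1 ∈ B₀ t ∧ z.1.2 ∈ B₁ t := fun z => z.2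
  choose f hf₁ hf₂ using h
  refine ⟨Finset.univ.image f, ?_, ?_, ?_⟩
  · intro t ht
    obtain ⟨z, -, rfl⟩ := Finset.mem_image.1 ht
    exact hf₁ z
  · exact Finset.card_image_le.trans
      (Fintype.card_le_of_injective (Subtype.val : coverSet s B₀ B₁ → A × B)
        Subtype.val_injective)
  · ext z
    constructor
    · rintro ⟨t, ht, h⟩
      obtain ⟨z', -, rfl⟩ := Finset.mem_image.1 ht
      exact ⟨_, hf₁ z', h⟩
    · intro hz
      exact ⟨f ⟨z, hz⟩, Finset.mem_image_of_mem _ (Finset.mem_univ _), hf₂ ⟨z, hz⟩⟩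

/-! ### Logarithmic levels and slices -/

/-- `x` lies in `(exp (-(k + 1)), exp (-k)]`. -/
def InLevel (k : ℕ) (x : ℝ) : Prop := Real.exp (-(k + 1 : ℝ)) < x ∧ x ≤ Real.exp (-(k : ℝ))

lemma exists_inLevel {L : ℕ} {x : ℝ} (h : Real.exp (-(L : ℝ)) ≤ x) (hx : x ≤ 1) :
    ∃ k ∈ Finset.range (L + 1), InLevel k x := by
  have hpos : 0 < x := (Real.exp_pos _).trans_le h
  have h1 : 0 ≤ -Real.log x := neg_nonneg.2 (Real.log_nonpos hpos.le hx)
  have h2 : -Real.log x ≤ L := by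
    have := (Real.le_log_iff_exp_le hpos).2 h
    linarith
  refine ⟨⌊-Real.log x⌋₊, ?_, ?_, ?_⟩
  · rw [Finset.mem_range, Nat.lt_succ_iff]
    exact Nat.floor_le_of_le h2
  · rw [← Real.lt_log_iff_exp_lt hpos]
    linarith [Nat.lt_floor_add_one (-Real.log x)]
  · rw [← Real.log_le_iff_le_exp hpos]
    linarith [Nat.floor_le h1]

lemma exists_exp_le_lt {L : ℕ} {x : ℝ} (h : 1 ≤ x) (hx : x ≤ Real.exp L) :
    ∃ j ∈ Finset.range (L + 1), Real.exp j ≤ x ∧ x < Real.exp (j + 1) := by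
  have hpos : 0 < x := one_pos.trans_le h
  refine ⟨⌊Real.log x⌋₊, ?_, ?_, ?_⟩
  · rw [Finset.mem_range, Nat.lt_succ_iff]
    exact Nat.floor_le_of_le ((Real.log_le_iff_le_exp hpos).2 hx)
  · rw [← Real.le_log_iff_exp_le hpos]
    exact Nat.floor_le (Real.log_nonneg h)
  · rw [← Real.log_lt_iff_lt_exp hpos]
    exact Nat.lt_floor_add_one _

open Classical in
/-- The section over `a` of a set of pairs. -/
def slice (X : Finset (A × A')) (a : A) : Finset A' := Finset.univ.filter fun a' => (a, a') ∈ X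

-- Markov's inequality for the weights of the slices.
open Classical in
lemma mul_sum_filter_slice_le (X : Finset (A × A')) (f : A → ℝ) (g : A' → ℝ) (hf : ∀ a, 0 ≤ f a)
    (hg : ∀ a, 0 ≤ g a) (c : ℝ) (Y : Finset A) (hY : ∀ a ∈ Y, c ≤ ∑ a' ∈ slice X a, g a') :
    c * ∑ a ∈ Y, f a ≤ ∑ x ∈ X, f x.1 * g x.2 := by
  calc c * ∑ a ∈ Y, f a = ∑ a ∈ Y, f a * c := by rw [Finset.mul_sum]; simp_rw [mul_comm c]
    _ ≤ ∑ a ∈ Y, f a * ∑ a' ∈ slice X a, g a' :=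
        Finset.sum_le_sum fun a ha => mul_le_mul_of_nonneg_left (hY a ha) (hf a)
    _ ≤ ∑ a, f a * ∑ a' ∈ slice X a, g a' :=
        Finset.sum_le_sum_of_subset_of_nonneg (Finset.subset_univ _) fun a _ _ =>
          mul_nonneg (hf a) (Finset.sum_nonneg fun a' _ => hg a')
    _ = ∑ x : A × A', if x ∈ X then f x.1 * g x.2 else 0 := by
        rw [Fintype.sum_prod_type]
        simp_rw [Finset.mul_sum, slice, Finset.sum_filter]
    _ = ∑ x ∈ X, f x.1 * g x.2 := by simp

lemma IsProbMatrix.sum_rowMarginal_le_one {N : Matrix A B ℝ} (hN : IsProbMatrix N)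
    (X : Finset A) : ∑ a ∈ X, rowMarginal N a ≤ 1 := by
  rw [← hN.sum_eq_one]
  exact Finset.sum_le_sum_of_subset_of_nonneg (Finset.subset_univ _) fun a _ _ =>
    rowMarginal_nonneg hN.nonneg a

lemma IsProbMatrix.sum_colMarginal_le_one {N : Matrix A B ℝ} (hN : IsProbMatrix N)
    (X : Finset B) : ∑ b ∈ X, colMarginal N b ≤ 1 := by
  have h : ∑ b, colMarginal N b = 1 := by
    rw [← hN.sum_eq_one]
    exact Finset.sum_comm
  rw [← h]
  exact Finset.sum_le_sum_of_subset_of_nonneg (Finset.subset_univ _) fun a _ _ =>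
    colMarginal_nonneg hN.nonneg a

lemma IsProbMatrix.coverProb_le_one {N : Matrix A B ℝ} (hN : IsProbMatrix N) {T : Type*}
    (s : Finset T) (B₀ : T → Finset A) (B₁ : T → Finset B) : coverProb N s B₀ B₁ ≤ 1 := by
  have h : ∑ z : A × B, N z.1 z.2 = 1 := (Fintype.sum_prod_type _).trans hN.sum_eq_one
  rw [← h]
  exact Finset.sum_le_sum fun z _ => Set.indicator_le_self' (fun _ _ => hN.nonneg _ _) z

open Classical in
/-- The indices in `s` of the bucket pairs whose marginal probabilities have levels `k`, `l`. -/
def levelFamily (N : Matrix A B ℝ) {T : Type*} (s : Finset T) (B₀ : T → Finset A)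
    (B₁ : T → Finset B) (k l : ℕ) : Finset T :=
  s.filter fun t => InLevel k (∑ a ∈ B₀ t, rowMarginal N a) ∧
    InLevel l (∑ b ∈ B₁ t, colMarginal N b)

/-- A bucket pair containing a pair of nonzero weight has both marginals at least that weight, hence
at least exp(-L), so it belongs to one of the listed levels. Pairs of weight zero contribute
nothing. -/
lemma coverProb_le_sum_levelFamily {N : Matrix A B ℝ} (hN : IsProbMatrix N) {L : ℕ}
    (hL : ∀ a b, N a b ≠ 0 → Real.exp (-(L : ℝ)) ≤ N a b) {T : Type*} (s : Finset T)
    (B₀ : T → Finset A) (B₁ : T → Finset B) :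
    coverProb N s B₀ B₁ ≤ ∑ k ∈ Finset.range (L + 1), ∑ l ∈ Finset.range (L + 1),
      coverProb N (levelFamily N s B₀ B₁ k l) B₀ B₁ := by
  classical
  unfold coverProb
  simp_rw [Finset.sum_comm (s := Finset.range (L + 1)) (t := Finset.univ)]
  refine Finset.sum_le_sum fun z _ => ?_
  have hnn : ∀ k l, 0 ≤ (coverSet (levelFamily N s B₀ B₁ k l) B₀ B₁).indicator
      (fun z => N z.1 z.2) z := fun k l => Set.indicator_nonneg (fun _ _ => hN.nonneg _ _) _
  by_cases hz : z ∈ coverSet s B₀ B₁ ∧ N z.1 z.2 ≠ 0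
  · obtain ⟨⟨t, hts, h₀, h₁⟩, hne⟩ := hz
    have hrow : Real.exp (-(L : ℝ)) ≤ ∑ a ∈ B₀ t, rowMarginal N a :=
      (hL _ _ hne).trans ((Finset.single_le_sum (f := fun b => N z.1 b)
        (fun b _ => hN.nonneg _ b) (Finset.mem_univ z.2)).trans
        (Finset.single_le_sum (f := rowMarginal N)
          (fun a _ => rowMarginal_nonneg hN.nonneg a) h₀))
    have hcol : Real.exp (-(L : ℝ)) ≤ ∑ b ∈ B₁ t, colMarginal N b :=
      (hL _ _ hne).trans ((Finset.single_le_sum (f := fun a => N a z.2)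
        (fun a _ => hN.nonneg a _) (Finset.mem_univ z.1)).trans
        (Finset.single_le_sum (f := colMarginal N)
          (fun a _ => colMarginal_nonneg hN.nonneg a) h₁))
    obtain ⟨k, hk, hk'⟩ := exists_inLevel hrow (hN.sum_rowMarginal_le_one _)
    obtain ⟨l, hl, hl'⟩ := exists_inLevel hcol (hN.sum_colMarginal_le_one _)
    calc (coverSet s B₀ B₁).indicator (fun z => N z.1 z.2) z ≤ N z.1 z.2 :=
          Set.indicator_le_self' (fun _ _ => hN.nonneg _ _) z
      _ = (coverSet (levelFamily N s B₀ B₁ k l) B₀ B₁).indicator (fun z => N z.1 z.2) z := by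
          rw [Set.indicator_of_mem]
          exact ⟨t, Finset.mem_filter.2 ⟨hts, hk', hl'⟩, h₀, h₁⟩
      _ ≤ _ := Finset.single_le_sum (f := fun l => (coverSet (levelFamily N s B₀ B₁ k l)
          B₀ B₁).indicator (fun z => N z.1 z.2) z) (fun l _ => hnn k l) hl
      _ ≤ _ := Finset.single_le_sum (f := fun k => ∑ l ∈ Finset.range (L + 1),
          (coverSet (levelFamily N s B₀ B₁ k l) B₀ B₁).indicator (fun z => N z.1 z.2) z)
          (fun k _ => Finset.sum_nonneg fun l _ => hnn k l) hk
  · have h0 : (coverSet s B₀ B₁).indicator (fun z => N z.1 z.2) z = 0 := by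
      rw [Set.indicator_apply_eq_zero]
      intro h
      by_contra h'
      exact hz ⟨h, h'⟩
    rw [h0]
    exact Finset.sum_nonneg fun k _ => Finset.sum_nonneg fun l _ => hnn k l

lemma exists_levels_of_coverProb {N : Matrix A B ℝ} (hN : IsProbMatrix N) {L : ℕ}
    (hL : ∀ a b, N a b ≠ 0 → Real.exp (-(L : ℝ)) ≤ N a b) {T : Type*} (s : Finset T)
    (hs : (s.card : ℝ) ≤ Real.exp L) (B₀ : T → Finset A) (B₁ : T → Finset B)
    (h : coverProb N s B₀ B₁ ≠ 0) :
    ∃ i ∈ Finset.range (L + 1), ∃ j ∈ Finset.range (L + 1), InLevel i (coverProb N s B₀ B₁) ∧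
      Real.exp j ≤ s.card ∧ s.card < Real.exp (j + 1) := by
  obtain ⟨z, -, hz⟩ := Finset.exists_ne_zero_of_sum_ne_zero h
  have hz' := Set.mem_of_indicator_ne_zero hz
  rw [Set.indicator_of_mem hz'] at hz
  have hle : Real.exp (-(L : ℝ)) ≤ coverProb N s B₀ B₁ := by
    refine (hL _ _ hz).trans ?_
    have := Finset.single_le_sum (f := (coverSet s B₀ B₁).indicator fun z => N z.1 z.2)
      (fun z _ => Set.indicator_nonneg (fun _ _ => hN.nonneg _ _) z) (Finset.mem_univ z)
    rwa [Set.indicator_of_mem hz'] at this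
  obtain ⟨t, ht, -⟩ := hz'
  have h1 : (1 : ℝ) ≤ s.card := by exact_mod_cast Finset.card_pos.2 ⟨t, ht⟩
  obtain ⟨i, hi, hi'⟩ := exists_inLevel hle (hN.coverProb_le_one _ _ _)
  obtain ⟨j, hj, hj'⟩ := exists_exp_le_lt h1 hs
  exact ⟨i, hi, j, hj, hi', hj'⟩

/-! ### Splitting a code for a Kronecker product -/

lemma coverProb_kronecker (M : Matrix A B ℝ) (N : Matrix A' B' ℝ) {T : Type*} (s : Finset T)
    (B₀ : T → Finset (A × A')) (B₁ : T → Finset (B × B')) :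
    coverProb (M ⊗ₖ N) s B₀ B₁ = ∑ z : A × B, M z.1 z.2 *
      coverProb N s (fun t => slice (B₀ t) z.1) (fun t => slice (B₁ t) z.2) := by
  classical
  unfold coverProb
  simp_rw [Finset.mul_sum]
  rw [← Fintype.sum_prod_type', ← Equiv.sum_comp (Equiv.prodProdProdComm A A' B B')]
  refine Finset.sum_congr rfl fun z _ => ?_
  simp [Set.indicator_apply, coverSet, slice, Matrix.kroneckerMap_apply]

open Classical in
/-- A code for `M ⊗ₖ N` splits into a code for `N`, all of whose bucket pairs have about the same
marginal probabilities, and a code for `M`. -/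
lemma CodeExists.split {M : Matrix A B ℝ} {N : Matrix A' B' ℝ} (hM : ∀ a b, 0 ≤ M a b)
    (hN : IsProbMatrix N) {L : ℕ} (hL : ∀ a b, N a b ≠ 0 → Real.exp (-(L : ℝ)) ≤ N a b)
    (hcard : (Fintype.card ((A × A') × (B × B')) : ℝ) ≤ Real.exp L) {n₀ n₁ S W : ℝ}
    (hn₀ : 0 < n₀) (hn₁ : 0 < n₁) (hS : 0 < S) (hW : 0 < W)
    (h : CodeExists (M ⊗ₖ N) n₀ n₁ S W) :
    ∃ k ∈ Finset.range (L + 1), ∃ l ∈ Finset.range (L + 1), ∃ i ∈ Finset.range (L + 1),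
      ∃ j ∈ Finset.range (L + 1),
      CodeExists N (Real.exp k) (Real.exp l) (Real.exp (-(i + 1 : ℝ))) (Real.exp (j + 1)) ∧
      CodeExists M (n₀ * Real.exp (-(k + 1 : ℝ))) (n₁ * Real.exp (-(l + 1 : ℝ)))
        (S * Real.exp i / (2 * (L + 1 : ℝ) ^ 4)) (2 * W / Real.exp j) := by
  have hMN : ∀ a b, 0 ≤ (M ⊗ₖ N) a b := fun a b => mul_nonneg (hM _ _) (hN.nonneg _ _)
  obtain ⟨n, B₀, B₁, hs, hw⟩ := h
  obtain ⟨s, -, hscard, hcover⟩ := exists_subfamily_card_le Finset.univ B₀ B₁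
  replace hs : S ≤ coverProb (M ⊗ₖ N) s B₀ B₁ := by
    unfold coverProb at hs ⊢
    rwa [hcover]
  let w : Fin n → ℝ := fun t => cost (n₀ * ∑ a ∈ B₀ t, rowMarginal (M ⊗ₖ N) a)
    (n₁ * ∑ b ∈ B₁ t, colMarginal (M ⊗ₖ N) b)
  have hw0 : ∀ t, 0 ≤ w t := fun t =>
    cost_nonneg (mul_nonneg hn₀.le (Finset.sum_nonneg fun _ _ => rowMarginal_nonneg hMN _))
  replace hw : ∑ t ∈ s, w t ≤ W :=
    (Finset.sum_le_sum_of_subset_of_nonneg (Finset.subset_univ _) fun t _ _ => hw0 t).trans hw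
  let C₀ : A × B → Fin n → Finset A' := fun z t => slice (B₀ t) z.1
  let C₁ : A × B → Fin n → Finset B' := fun z t => slice (B₁ t) z.2
  let F : ℕ → ℕ → A × B → Finset (Fin n) := fun k l z => levelFamily N s (C₀ z) (C₁ z) k l
  let σ : ℕ → ℕ → A × B → ℝ := fun k l z => coverProb N (F k l z) (C₀ z) (C₁ z)
  let X : ℕ × ℕ × ℕ × ℕ → Finset (A × B) := fun p => Finset.univ.filter fun z =>
    InLevel p.2.2.1 (σ p.1 p.2.1 z) ∧ Real.exp p.2.2.2 ≤ (F p.1 p.2.1 z).card ∧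
      (F p.1 p.2.1 z).card < Real.exp (p.2.2.2 + 1)
  let r := Finset.range (L + 1)
  have hFcard : ∀ k l z, ((F k l z).card : ℝ) ≤ Real.exp L := by
    intro k l z
    refine le_trans ?_ hcard
    exact_mod_cast (Finset.card_filter_le _ _).trans hscard
  have hσ : ∀ k l z, σ k l z ≤ ∑ i ∈ r, ∑ j ∈ r,
      if z ∈ X (k, l, i, j) then Real.exp (-(i : ℝ)) else 0 := by
    intro k l z
    have hnn : ∀ i j, (0 : ℝ) ≤ if z ∈ X (k, l, i, j) then Real.exp (-(i : ℝ)) else 0 := by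
      intro i j
      split_ifs <;> positivity
    by_cases h0 : σ k l z = 0
    · rw [h0]
      exact Finset.sum_nonneg fun i _ => Finset.sum_nonneg fun j _ => hnn i j
    · obtain ⟨i, hi, j, hj, h₁, h₂⟩ :=
        exists_levels_of_coverProb hN hL (F k l z) (hFcard k l z) (C₀ z) (C₁ z) h0
      have hz : z ∈ X (k, l, i, j) := Finset.mem_filter.2 ⟨Finset.mem_univ _, h₁, h₂⟩
      calc σ k l z ≤ if z ∈ X (k, l, i, j) then Real.exp (-(i : ℝ)) else 0 := by
            rw [if_pos hz]
            exact h₁.2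
        _ ≤ _ := Finset.single_le_sum
            (f := fun j => if z ∈ X (k, l, i, j) then Real.exp (-(i : ℝ)) else 0)
            (fun j _ => hnn i j) hj
        _ ≤ _ := Finset.single_le_sum
            (f := fun i => ∑ j ∈ r, if z ∈ X (k, l, i, j) then Real.exp (-(i : ℝ)) else 0)
            (fun i _ => Finset.sum_nonneg fun j _ => hnn i j) hi
  have hsum : S ≤ ∑ p ∈ r ×ˢ r ×ˢ r ×ˢ r,
      Real.exp (-(p.2.2.1 : ℝ)) * ∑ z ∈ X p, M z.1 z.2 := by
    calc S ≤ ∑ z : A × B, M z.1 z.2 * coverProb N s (C₀ z) (C₁ z) := by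
          rwa [coverProb_kronecker] at hs
      _ ≤ ∑ z : A × B, M z.1 z.2 * ∑ k ∈ r, ∑ l ∈ r, ∑ i ∈ r, ∑ j ∈ r,
            if z ∈ X (k, l, i, j) then Real.exp (-(i : ℝ)) else 0 := by
          refine Finset.sum_le_sum fun z _ => mul_le_mul_of_nonneg_left ?_ (hM _ _)
          exact (coverProb_le_sum_levelFamily hN hL s (C₀ z) (C₁ z)).trans
            (Finset.sum_le_sum fun k _ => Finset.sum_le_sum fun l _ => hσ k l z)
      _ = ∑ z : A × B, ∑ p ∈ r ×ˢ r ×ˢ r ×ˢ r,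
            if z ∈ X p then Real.exp (-(p.2.2.1 : ℝ)) * M z.1 z.2 else 0 := by
          refine Finset.sum_congr rfl fun z _ => ?_
          simp_rw [Finset.sum_product, Finset.mul_sum, mul_ite, mul_zero, mul_comm (M z.1 z.2)]
      _ = _ := by
          rw [Finset.sum_comm]
          refine Finset.sum_congr rfl fun p _ => ?_
          rw [Finset.mul_sum, ← Finset.sum_filter]
          simp
  -- Pigeonhole over the (L+1)^4 classes.
  obtain ⟨⟨k, l, i, j⟩, hp, hkey⟩ : ∃ p ∈ r ×ˢ r ×ˢ r ×ˢ r,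
      S / (L + 1 : ℝ) ^ 4 ≤ Real.exp (-(p.2.2.1 : ℝ)) * ∑ z ∈ X p, M z.1 z.2 := by
    refine Finset.exists_le_of_sum_le (s := r ×ˢ r ×ˢ r ×ˢ r)
      (f := fun _ => S / (L + 1 : ℝ) ^ 4) ⟨(0, 0, 0, 0), by simp [r]⟩ (le_trans (le_of_eq ?_) hsum)
    simp only [Finset.sum_const, Finset.card_product, nsmul_eq_mul, r, Finset.card_range]
    push_cast
    field_simp
  simp only [Finset.mem_product] at hp
  obtain ⟨hk, hl, hi, hj⟩ := hp
  refine ⟨k, hk, l, hl, i, hi, j, hj, ?_, ?_⟩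
  · obtain ⟨z, hz⟩ : (X (k, l, i, j)).Nonempty := by
      rw [Finset.nonempty_iff_ne_empty]
      intro h0
      rw [h0, Finset.sum_empty, mul_zero] at hkey
      exact absurd hkey (not_le.2 (by positivity))
    obtain ⟨-, hz₁, -, hz₂⟩ := Finset.mem_filter.1 hz
    refine CodeExists.of_family (F k l z) (C₀ z) (C₁ z) hz₁.1.le (le_trans ?_ hz₂.le)
    -- With n₀ = exp(k) and n₁ = exp(l), levels k and l make each bucket pair cost at most 1, so the
    -- work is at most the number of pairs.
    refine (Finset.sum_le_card_nsmul _ _ 1 fun t ht => ?_).trans (by simp)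
    obtain ⟨-, ht₀, ht₁⟩ := Finset.mem_filter.1 ht
    have hle : ∀ {k : ℕ} {x : ℝ}, InLevel k x → Real.exp k * x ≤ 1 := by
      intro k x hx
      calc Real.exp k * x ≤ Real.exp k * Real.exp (-(k : ℝ)) := by gcongr; exact hx.2
        _ = 1 := by rw [← Real.exp_add]; simp
    exact cost_le_one (mul_nonneg (Real.exp_pos _).le ((Real.exp_pos _).le.trans ht₁.1.le))
      (hle ht₀) (hle ht₁)
  · let D₀ : Fin n → Finset A := fun t => Finset.univ.filter fun a =>
      InLevel k (∑ a' ∈ slice (B₀ t) a, rowMarginal N a')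
    let D₁ : Fin n → Finset B := fun t => Finset.univ.filter fun b =>
      InLevel l (∑ b' ∈ slice (B₁ t) b, colMarginal N b')
    -- The indices t with z in D₀ t × D₁ t are exactly those of the level family over z, so z is
    -- covered at least exp(j) times.
    obtain ⟨R, -, hRw, hRc⟩ := exists_subcover s w hw0 (fun t => {z : A × B | z.1 ∈ D₀ t ∧ z.2 ∈ D₁ t})
      (X (k, l, i, j)) (fun z => M z.1 z.2) (fun z => hM _ _) (Real.exp_pos j) hW hw (by
        intro z hz
        refine (Finset.mem_filter.1 hz).2.2.1.trans (le_of_eq ?_)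
        simp only [F, levelFamily, C₀, C₁]
        congr 2
        ext t
        simp [D₀, D₁])
    refine CodeExists.of_family R D₀ D₁ ?_ (le_trans ?_ hRw)
    · calc S * Real.exp i / (2 * (L + 1 : ℝ) ^ 4)
          = S / (L + 1 : ℝ) ^ 4 * Real.exp i / 2 := by field_simp
        _ ≤ Real.exp (-(i : ℝ)) * (∑ z ∈ X (k, l, i, j), M z.1 z.2) * Real.exp i / 2 := by
            gcongr
        _ = (∑ z ∈ X (k, l, i, j), M z.1 z.2) / 2 := by
            rw [Real.exp_neg]
            field_simp
        _ ≤ _ := hRc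
        _ ≤ coverProb M R D₀ D₁ := by
            unfold coverProb
            rw [Finset.sum_filter]
            refine (Finset.sum_le_sum_of_subset_of_nonneg (Finset.subset_univ _) ?_).trans
              (Finset.sum_le_sum fun z _ => le_of_eq ?_)
            · intro z _ _
              split_ifs <;> simp [hM]
            · simp [Set.indicator_apply, coverSet]
    · refine Finset.sum_le_sum fun t _ => ?_
      -- The factors exp(-(k+1)) and exp(-(l+1)) are the lower ends of the levels, so the cost of
      -- each new bucket pair with the scaled n₀ and n₁ is at most the old cost.
      have h₀ := mul_sum_filter_slice_le (B₀ t) (rowMarginal M) (rowMarginal N)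
        (rowMarginal_nonneg hM) (rowMarginal_nonneg hN.nonneg) (Real.exp (-(k + 1 : ℝ))) (D₀ t)
        (fun a ha => (Finset.mem_filter.1 ha).2.1.le)
      have h₁ := mul_sum_filter_slice_le (B₁ t) (colMarginal M) (colMarginal N)
        (colMarginal_nonneg hM) (colMarginal_nonneg hN.nonneg) (Real.exp (-(l + 1 : ℝ))) (D₁ t)
        (fun a ha => (Finset.mem_filter.1 ha).2.1.le)
      simp_rw [← rowMarginal_kronecker] at h₀
      simp_rw [← colMarginal_kronecker] at h₁
      rw [mul_assoc, mul_assoc]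
      refine cost_mono ?_ ?_ (by gcongr) (by gcongr)
      · exact mul_nonneg hn₀.le (Finset.sum_nonneg fun _ _ => rowMarginal_nonneg hMN _)
      · exact mul_nonneg hn₁.le (mul_nonneg (Real.exp_pos _).le
          (Finset.sum_nonneg fun _ _ => colMarginal_nonneg hM _))

/-! ### Large tensor powers and the vanishing error -/

lemma exists_exp_neg_le (P : Matrix A B ℝ) (hP : ∀ a b, 0 ≤ P a b) (x : ℝ) :
    ∃ l : ℕ, 1 ≤ l ∧ x ≤ l ∧ ∀ a b, P a b ≠ 0 → Real.exp (-(l : ℝ)) ≤ P a b := by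
  obtain ⟨c, hc⟩ := (Set.finite_range fun z : A × B => -Real.log (P z.1 z.2)).bddAbove
  obtain ⟨l, hl⟩ := exists_nat_ge (max (max c x) 1)
  simp only [max_le_iff] at hl
  refine ⟨l, by exact_mod_cast hl.2, hl.1.2, fun a b hab => ?_⟩
  rw [← Real.le_log_iff_exp_le ((hP a b).lt_of_ne' hab)]
  have := hc ⟨(a, b), rfl⟩
  simp only at this
  linarith [hl.1.1]

lemma exp_neg_le_tensorPow {P : Matrix A B ℝ} {l : ℕ}
    (hl : ∀ a b, P a b ≠ 0 → Real.exp (-(l : ℝ)) ≤ P a b) (d : ℕ) (x : Fin d → A) (y : Fin d → B)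
    (h : tensorPow P d x y ≠ 0) : Real.exp (-((d * l : ℕ) : ℝ)) ≤ tensorPow P d x y := by
  have he : Real.exp (-((d * l : ℕ) : ℝ)) = ∏ _i : Fin d, Real.exp (-(l : ℝ)) := by
    simp [← Real.exp_nat_mul]
  rw [he]
  exact Finset.prod_le_prod (fun _ _ => (Real.exp_pos _).le) fun i _ =>
    hl _ _ (Finset.prod_ne_zero_iff.1 h i (Finset.mem_univ i))

lemma card_pow_le_exp {l : ℕ} (h : (Fintype.card ((A × A') × (B × B')) : ℝ) ≤ l) (d : ℕ) :
    (Fintype.card (((Fin d → A) × (Fin d → A')) × ((Fin d → B) × (Fin d → B'))) : ℝ) ≤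
      Real.exp (d * l : ℕ) := by
  have h' : (Fintype.card ((A × A') × (B × B')) : ℝ) ≤ Real.exp l :=
    h.trans (by linarith [Real.add_one_le_exp (l : ℝ)])
  rw [Nat.cast_mul, Real.exp_nat_mul]
  refine le_trans (le_of_eq ?_) (pow_le_pow_left₀ (by positivity) h' d)
  simp [mul_pow]

/-- The polynomial loss (L+1)^4 with L = D * l disappears at the scale of exponents. -/
lemma tendsto_log_mul_add_one_div {l : ℕ} (hl : 1 ≤ l) {D : ℕ → ℕ}
    (hD : Filter.Tendsto D Filter.atTop Filter.atTop) :
    Filter.Tendsto (fun n => Real.log ((D n * l : ℕ) + 1) / D n) Filter.atTop (nhds 0) := by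
  have hl0 : (0 : ℝ) < l := by exact_mod_cast hl
  have h := Real.tendsto_pow_log_div_mul_add_atTop (1 / l : ℝ) (-(1 / l)) 1 (by positivity)
  have hx : Filter.Tendsto (fun n => ((D n * l : ℕ) : ℝ) + 1) Filter.atTop Filter.atTop := by
    push_cast
    exact Filter.tendsto_atTop_add_const_right _ _
      ((tendsto_natCast_atTop_atTop.comp hD).atTop_mul_const hl0)
  refine (h.comp hx).congr fun n => ?_
  simp only [Function.comp, pow_one]
  congr 1
  push_cast
  field_simp
  ring

/-- Every large tensor power of an attainable point of `P ⊗ₖ Q` splits, up to a small error, into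
points for `P` and `Q`, the latter one in a bounded box. -/
lemma exists_logAttainable_add_eq {P : Matrix A B ℝ} {Q : Matrix A' B' ℝ}
    (hP : ∀ a b, 0 ≤ P a b) (hQ : IsProbMatrix Q) {l : ℕ}
    (hl : ∀ a b, Q a b ≠ 0 → Real.exp (-(l : ℝ)) ≤ Q a b)
    (hcard : (Fintype.card ((A × A') × (B × B')) : ℝ) ≤ l) {d : ℕ} {n₀ n₁ S W : ℝ}
    (h : Attainable (P ⊗ₖ Q) d n₀ n₁ S W) (hS : 0 < S) (hW : 0 < W) (m : ℕ) :
    ∃ u ∈ logAttainable P,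
      ∃ v ∈ logAttainable Q ∩ Set.Icc (0, 0, 0, 0) ((l + 1 : ℝ), (l + 1 : ℝ), (l + 1 : ℝ), (l + 1 : ℝ)),
      u + v = (Real.log n₀ / d - 1 / ((m + 1) * d : ℕ), Real.log n₁ / d - 1 / ((m + 1) * d : ℕ),
        -Real.log S / d + (Real.log 2 + 1) * (1 / ((m + 1) * d : ℕ)) +
          4 * (Real.log (((m + 1) * d * l : ℕ) + 1) / ((m + 1) * d : ℕ)),
        Real.log W / d + (Real.log 2 + 1) * (1 / ((m + 1) * d : ℕ))) := by
  have hd : 1 ≤ d := h.1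
  have hn₀ := h.2.1
  have hn₁ := h.2.2.1
  have hPQ : ∀ a b, 0 ≤ (P ⊗ₖ Q) a b := fun a b => mul_nonneg (hP _ _) (hQ.nonneg _ _)
  have hp := h.pow hPQ m
  set D := (m + 1) * d with hD
  have hD1 : 1 ≤ D := Nat.mul_pos (Nat.succ_pos m) hd
  have hDpos : (0 : ℝ) < D := by exact_mod_cast hD1
  have hdpos : (0 : ℝ) < d := by exact_mod_cast hd
  have hDd : ∀ x : ℝ, (m + 1 : ℝ) * x / D = x / d := by
    intro x
    rw [hD]
    push_cast
    field_simp
  obtain ⟨-, -, -, -, hcode⟩ := attainable_iff.1 hp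
  have hcode' : CodeExists (tensorPow P D ⊗ₖ tensorPow Q D) (n₀ ^ (m + 1)) (n₁ ^ (m + 1))
      (S ^ (m + 1)) (W ^ (m + 1)) := by
    rw [tensorPow_kronecker] at hcode
    have := hcode.reindex
      (Equiv.arrowProdEquivProdArrow (Fin D) (fun _ => A) (fun _ => A')).symm
      (Equiv.arrowProdEquivProdArrow (Fin D) (fun _ => B) (fun _ => B')).symm
    simpa [Matrix.submatrix_submatrix] using this
  obtain ⟨k₀, hk₀, k₁, hk₁, i, hi, j, hj, hcQ, hcP⟩ := hcode'.split (tensorPow_nonneg hP D)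
    (hQ.tensorPow D) (exp_neg_le_tensorPow hl D) (card_pow_le_exp hcard D) (by positivity)
    (by positivity) (by positivity) (by positivity)
  have hbd : ∀ {k : ℕ}, k ∈ Finset.range (D * l + 1) → (k : ℝ) / D ≤ l ∧ (k + 1 : ℝ) / D ≤ l + 1 := by
    intro k hk
    have h1 : k ≤ D * l := Nat.lt_succ_iff.1 (Finset.mem_range.1 hk)
    have h2 : (k : ℝ) ≤ D * l := by exact_mod_cast h1
    have h3 : (1 : ℝ) ≤ D := by exact_mod_cast hD1
    constructor
    · rw [div_le_iff₀ hDpos]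
      linarith
    · rw [div_le_iff₀ hDpos]
      linarith
  refine ⟨_, ⟨D, _, _, _, _, attainable_iff.2 ⟨hD1, by positivity, by positivity, by positivity, hcP⟩,
    by positivity, by positivity, rfl⟩, _, ⟨⟨D, _, _, _, _, attainable_iff.2 ⟨hD1, by positivity,
    by positivity, by positivity, hcQ⟩, by positivity, by positivity, rfl⟩, ?_⟩, ?_⟩
  · simp only [Real.log_exp, neg_neg]
    refine ⟨⟨?_, ?_, ?_, ?_⟩, ?_, ?_, ?_, ?_⟩
    · positivity
    · positivity
    · positivity
    · positivity
    · linarith [(hbd hk₀).1]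
    · linarith [(hbd hk₁).1]
    · exact (hbd hi).2
    · exact (hbd hj).2
  · have hL : (0 : ℝ) < ((D * l : ℕ) : ℝ) + 1 := by positivity
    rw [Real.log_mul (by positivity) (by positivity), Real.log_mul (by positivity) (by positivity),
      Real.log_div (by positivity) (by positivity), Real.log_mul (by positivity) (by positivity),
      Real.log_mul (by positivity) (by positivity), Real.log_div (by positivity) (by positivity),
      Real.log_mul (by positivity) (by positivity)]
    simp only [Real.log_exp, Real.log_pow, Prod.mk_add_mk, Nat.cast_add, Nat.cast_one,
      Nat.cast_ofNat]
    rw [← hDd (Real.log n₀), ← hDd (Real.log n₁), ← hDd (-Real.log S), ← hDd (Real.log W)]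
    -- The parameters k₀, k₁, i and j cancel between the two codes. What remains are the rounding
    -- factors e, the two factors 2, and (L+1)^4.
    refine Prod.ext ?_ (Prod.ext ?_ (Prod.ext ?_ ?_)) <;> simp only <;> ring

lemma logAttainable_kronecker_subset {P : Matrix A B ℝ} {Q : Matrix A' B' ℝ}
    (hP : ∀ a b, 0 ≤ P a b) (hQ : IsProbMatrix Q) {l : ℕ} (hl1 : 1 ≤ l)
    (hl : ∀ a b, Q a b ≠ 0 → Real.exp (-(l : ℝ)) ≤ Q a b)
    (hcard : (Fintype.card ((A × A') × (B × B')) : ℝ) ≤ l) :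
    logAttainable (P ⊗ₖ Q) ⊆ closure (logAttainable P + logAttainable Q ∩
      Set.Icc (0, 0, 0, 0) ((l + 1 : ℝ), (l + 1 : ℝ), (l + 1 : ℝ), (l + 1 : ℝ))) := by
  rintro _ ⟨d, n₀, n₁, S, W, h, hS, hW, rfl⟩
  choose u hu v hv huv using exists_logAttainable_add_eq hP hQ hl hcard h hS hW
  have hD : Filter.Tendsto (fun m => (m + 1) * d) Filter.atTop Filter.atTop :=
    Filter.tendsto_atTop_mono (fun m => (Nat.le_succ m).trans (Nat.le_mul_of_pos_right _ h.1))
      Filter.tendsto_id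
  have h1 : Filter.Tendsto (fun m => 1 / (((m + 1) * d : ℕ) : ℝ)) Filter.atTop (nhds 0) :=
    tendsto_one_div_atTop_nhds_zero_nat.comp hD
  have h2 := tendsto_log_mul_add_one_div hl1 hD
  refine mem_closure_of_tendsto (f := fun m => u m + v m) (b := Filter.atTop) ?_
    (Filter.Eventually.of_forall fun m => Set.add_mem_add (hu m) (hv m))
  simp_rw [huv]
  refine Filter.Tendsto.prodMk_nhds ?_ (Filter.Tendsto.prodMk_nhds ?_
    (Filter.Tendsto.prodMk_nhds ?_ ?_))
  · simpa using h1.const_sub (Real.log n₀ / d)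
  · simpa using h1.const_sub (Real.log n₁ / d)
  · simpa using ((h1.const_mul (Real.log 2 + 1)).const_add (-Real.log S / d)).add (h2.const_mul 4)
  · simpa using (h1.const_mul (Real.log 2 + 1)).const_add (Real.log W / d)

end Bucketing

end

/-! ### Conclusion by compactness -/

theorem mainTheorem10 {ι₁ κ₁ ι₂ κ₂ : Type*} [Fintype ι₁] [Fintype κ₁] [Fintype ι₂] [Fintype κ₂]
    (P₁ : Matrix ι₁ κ₁ ℝ) (P₂ : Matrix ι₂ κ₂ ℝ)
    (h₁ : Bucketing.IsProbMatrix P₁) (h₂ : Bucketing.IsProbMatrix P₂) :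
    closure (Bucketing.logAttainable (P₁ ⊗ₖ P₂)) =
      closure (Bucketing.logAttainable P₁) + closure (Bucketing.logAttainable P₂) := by
  refine Set.Subset.antisymm ?_ ?_
  · obtain ⟨l, hl1, hcard, hl⟩ := Bucketing.exists_exp_neg_le P₂ h₂.nonneg
      (Fintype.card ((ι₁ × ι₂) × (κ₁ × κ₂)))
    set K : Set (ℝ × ℝ × ℝ × ℝ) :=
      Set.Icc (0, 0, 0, 0) ((l + 1 : ℝ), (l + 1 : ℝ), (l + 1 : ℝ), (l + 1 : ℝ))
    have hK : IsCompact (closure (Bucketing.logAttainable P₂) ∩ K) :=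
      isCompact_Icc.inter_left isClosed_closure
    -- A Minkowski sum of two closed sets need not be closed; restricting the second summand to the
    -- compact box `K` makes it so.
    have hclosed : IsClosed (closure (Bucketing.logAttainable P₁) +
        closure (Bucketing.logAttainable P₂) ∩ K) := isClosed_closure.add_right_of_isCompact hK
    refine (closure_minimal ?_ hclosed).trans (Set.add_subset_add_left Set.inter_subset_left)
    refine (Bucketing.logAttainable_kronecker_subset h₁.nonneg h₂ hl1 hl hcard).trans
      (closure_minimal ?_ hclosed)
    exact Set.add_subset_add subset_closure (Set.inter_subset_inter_left _ subset_closure)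
  · refine Set.Subset.trans ?_
      (closure_mono (Bucketing.logAttainable_add_subset h₁.nonneg h₂.nonneg))
    rintro _ ⟨u, hu, v, hv, rfl⟩
    exact map_mem_closure₂ continuous_add hu hv fun a ha b hb => Set.add_mem_add ha hb
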